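/- Let $n\ge 0$ and $m\ge 1$ be integers, let $X_1,\dots,X_m\subseteq\mathbb{R}^n$ be bounded open sets, and let $\mu_i$ be a Borel probability measure on $X_i$, $i=1,\dots,m$. Let $G$ be a simple undirected graph with vertices $v_1,\dots,v_m$, maximal cliques $S_1,\dots,S_l$ and inner hub $A\subseteq V(G)$; that is, $V(S_j)\cap V(S_k)=A$ for all $j\ne k$, and $A=V(G)$ if $G$ is complete (the case $l=1$). Let $$b(x_1,\dots,x_m)=\sum_{\{v_i,v_j\}\in E(G)}x_i\cdot x_j$$ be the surplus associated to $G$. Suppose that $\mu_1$ is absolutely continuous with respect to the Lebesgue measure $\mathcal{L}^n$, and that $\mu_p$ is absolutely continuous with respect to $\mathcal{L}^n$ for some $p$ with $v_p\in A$. Then every solution $\gamma$ of the Kantorovich problem, that is, every maximizer $\gamma$ of $\int b\,d\gamma$ among the Borel probability measures on $X_1\times\dots\times X_m$ with marginals $\mu_1,\dots,\mu_m$, is induced by a map: there are Borel maps $T_i:X_1\to X_i$, $i=2,\dots,m$, with $(T_i)_\sharp\mu_1=\mu_i$ and $\gamma=(\mathrm{Id},T_2,\dots,T_m)_\sharp\mu_1$.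 -/

import Mathlib

open MeasureTheory

/-- `A` is the inner hub of `G`: any two distinct maximal cliques of `G` intersect exactly in `A`.
A complete graph has a single maximal clique; its inner hub is the whole vertex set. -/
def IsInnerHub {V : Type*} (G : SimpleGraph V) (A : Set V) : Prop :=
  (∀ S T : Set V, Maximal G.IsClique S → Maximal G.IsClique T → S ≠ T → S ∩ T = A) ∧
    (G = ⊤ → A = Set.univ)

open Classical in
/-- The surplus `b(x₁, …, xₘ) = ∑_{ {i,j} ∈ E(G) } xᵢ ⬝ xⱼ` on `X₁ × ⋯ × Xₘ`; each edge is counted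
once, through its endpoints in increasing order. -/
noncomputable def graphSurplus {n m : ℕ} (G : SimpleGraph (Fin m))
    {X : Fin m → Set (EuclideanSpace ℝ (Fin n))} (x : ∀ i, X i) : ℝ :=
  ∑ e : Fin m × Fin m with e.1 < e.2 ∧ G.Adj e.1 e.2,
    inner ℝ (x e.1 : EuclideanSpace ℝ (Fin n)) (x e.2 : EuclideanSpace ℝ (Fin n))

/-- `γ` is a probability measure on the product whose `i`-th marginal is `μ i` for all `i`. -/
def HasMarginals {ι : Type*} {Y : ι → Type*} [∀ i, MeasurableSpace (Y i)]
    (μ : ∀ i, Measure (Y i)) (γ : Measure (∀ i, Y i)) : Prop :=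
  IsProbabilityMeasure γ ∧ ∀ i, γ.map (fun x => x i) = μ i

/-- `γ` solves the Kantorovich problem: it maximizes `∫ b dγ` among all probability measures on
the product with marginals `μ i`. -/
def IsKantorovichSolution {ι : Type*} {Y : ι → Type*} [∀ i, MeasurableSpace (Y i)]
    (b : (∀ i, Y i) → ℝ) (μ : ∀ i, Measure (Y i)) (γ : Measure (∀ i, Y i)) : Prop :=
  HasMarginals μ γ ∧ ∀ γ' : Measure (∀ i, Y i), HasMarginals μ γ' → ∫ x, b x ∂γ' ≤ ∫ x, b x ∂γ

/-- `γ` is induced by a map over the coordinate `i₀`: there are measurable `T i : Y i₀ → Y i`, with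
`T i₀` the identity, that push `μ i₀` forward to `μ i`, such that `γ` is the image of `μ i₀`
under `x ↦ (T i x)ᵢ`. -/
def IsInducedByMap {ι : Type*} {Y : ι → Type*} [∀ i, MeasurableSpace (Y i)]
    (i₀ : ι) (μ : ∀ i, Measure (Y i)) (γ : Measure (∀ i, Y i)) : Prop :=
  ∃ T : ∀ i, Y i₀ → Y i, (∀ i, Measurable (T i)) ∧ T i₀ = id ∧
    (∀ i, (μ i₀).map (T i) = μ i) ∧ γ = (μ i₀).map (fun x i => T i x)

/-! Optimality makes the support of γ stable under rearrangement
(`IsKantorovichSolution.isJointlyMonotone_support`). An exchange between two support points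
preserves the total surplus when, on every edge leaving the exchanged set, the points agree at an
endpoint. The resulting mixtures therefore inherit monotonicity: the pairs (coordinate at v, sum of
the neighbouring coordinates) are cyclically monotone. By Rockafellar and Rademacher, the coordinate
at v determines the neighbour sum off a Lebesgue null set; absolute continuity makes this usable at
v = 0 and v = p.

Let d be the difference of two support points with the same generic coordinate at 0. Then d and its
neighbour sum vanish at 0, and `eq_zero_of_exchange_nonneg` gives d = 0. Hub vertices see every
vertex and other vertices see the hub and their own clique, so the exchange inequalities kill d on
the hub; single-valuedness for mixtures at p then kills it on each remaining clique. Hence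
coordinate 0 is injective on a Borel set of full measure, and its inverse gives the map. -/

open scoped RealInnerProductSpace NNReal ENNReal

/-! ### Cyclical monotonicity and almost everywhere single-valuedness -/

/-- A subset of `E × E` is cyclically monotone if it satisfies Rockafellar's condition along
every finite cycle. -/
def IsCyclicallyMonotone {E : Type*} [NormedAddCommGroup E] [InnerProductSpace ℝ E]
    (R : Set (E × E)) : Prop :=
  ∀ (k : ℕ) (f : ℕ → E × E), (∀ i, f i ∈ R) →
    ∑ i ∈ Finset.range k, ⟪(f i).2, (f (i + 1)).1 - (f i).1⟫
      + ⟪(f k).2, (f 0).1 - (f k).1⟫ ≤ 0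

/-- Rockafellar's theorem for bounded subgradients: a cyclically monotone set is contained in the
subdifferential of a Lipschitz function. -/
theorem IsCyclicallyMonotone.exists_lipschitz_potential {E : Type*} [NormedAddCommGroup E]
    [InnerProductSpace ℝ E] {R : Set (E × E)} (hR : IsCyclicallyMonotone R) {M : ℝ≥0}
    (hM : ∀ r ∈ R, ‖r.2‖ ≤ M) :
    ∃ φ : E → ℝ, LipschitzWith M φ ∧ ∀ r ∈ R, ∀ x, φ r.1 + ⟪r.2, x - r.1⟫ ≤ φ x := by
  classical
  rcases R.eq_empty_or_nonempty with rfl | ⟨r₀, hr₀⟩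
  · exact ⟨0, LipschitzWith.const' 0, by simp⟩
  -- Rockafellar's potential at x is the supremum of these sums over chains in `R` from `r₀`; only
  -- the entries up to index `q.1` of the sequence count.
  let c : ℕ × (ℕ → E × E) → E → ℝ := fun q x =>
    ∑ i ∈ Finset.range q.1, ⟪(q.2 i).2, (q.2 (i + 1)).1 - (q.2 i).1⟫
      + ⟪(q.2 q.1).2, x - (q.2 q.1).1⟫
  let S : Type _ := {q : ℕ × (ℕ → E × E) // (∀ i, q.2 i ∈ R) ∧ q.2 0 = r₀}
  have : Nonempty S := ⟨⟨(0, fun _ => r₀), fun _ => hr₀, rfl⟩⟩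
  have hlip : ∀ (q : S) (x y : E), c q x ≤ c q y + M * ‖x - y‖ := by
    intro q x y
    have h1 : ⟪(q.1.2 q.1.1).2, x - y⟫ ≤ M * ‖x - y‖ :=
      (real_inner_le_norm _ _).trans (by gcongr; exact hM _ (q.2.1 _))
    have h2 : x - (q.1.2 q.1.1).1 = (y - (q.1.2 q.1.1).1) + (x - y) := by abel
    simp only [c]
    rw [h2, inner_add_right]
    linarith
  have hbdd : ∀ x, BddAbove (Set.range fun q : S => c q x) := by
    intro x
    refine ⟨M * ‖x - r₀.1‖, ?_⟩
    rintro _ ⟨q, rfl⟩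
    have h1 := hlip q x r₀.1
    have h2 := hR q.1.1 q.1.2 q.2.1
    rw [q.2.2] at h2
    simp only [c] at h1 ⊢
    linarith
  refine ⟨fun x => ⨆ q : S, c q x, LipschitzWith.of_le_add_mul M fun x y => ?_, ?_⟩
  · refine ciSup_le fun q => (hlip q x y).trans ?_
    rw [dist_eq_norm]
    gcongr
    exact le_ciSup (hbdd y) q
  · intro r hr x
    rw [← le_sub_iff_add_le]
    refine ciSup_le fun q => ?_
    rw [le_sub_iff_add_le]
    -- Appending r to a chain yields the subgradient inequality at r.
    let f : ℕ → E × E := fun i => if i ≤ q.1.1 then q.1.2 i else r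
    have hf : (∀ i, f i ∈ R) ∧ f 0 = r₀ := by
      refine ⟨fun i => ?_, by simp [f, q.2.2]⟩
      by_cases h : i ≤ q.1.1
      · simpa [f, h] using q.2.1 i
      · simpa [f, h] using hr
    refine le_trans (le_of_eq ?_) (le_ciSup (hbdd x) ⟨(q.1.1 + 1, f), hf⟩)
    have h1 : f (q.1.1 + 1) = r := by simp [f]
    have h2 : f q.1.1 = q.1.2 q.1.1 := by simp [f]
    have h3 : ∀ i ∈ Finset.range q.1.1, ⟪(f i).2, (f (i + 1)).1 - (f i).1⟫
        = ⟪(q.1.2 i).2, (q.1.2 (i + 1)).1 - (q.1.2 i).1⟫ := by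
      intro i hi
      have hi' := Finset.mem_range.1 hi
      simp [f, hi'.le, Nat.succ_le_of_lt hi']
    simp only [c, Finset.sum_range_succ, h1, h2, Finset.sum_congr rfl h3]

/-- A subgradient at a point of differentiability is the gradient. -/
theorem inner_eq_fderiv_of_subgradient {E : Type*} [NormedAddCommGroup E]
    [InnerProductSpace ℝ E] {φ : E → ℝ} {x y : E} (hφ : DifferentiableAt ℝ φ x)
    (hy : ∀ z, φ x + ⟪y, z - x⟫ ≤ φ z) (v : E) : ⟪y, v⟫ = fderiv ℝ φ x v := by
  have hmin : IsLocalMin (fun z => φ z - ⟪y, z⟫) x := by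
    refine Filter.Eventually.of_forall fun z => ?_
    have := hy z
    rw [inner_sub_right] at this
    simp only
    linarith
  have hd : HasFDerivAt (fun z => φ z - ⟪y, z⟫) (fderiv ℝ φ x - innerSL ℝ y) x :=
    hφ.hasFDerivAt.sub (innerSL ℝ y).hasFDerivAt
  have := congrArg (fun L : E →L[ℝ] ℝ => L v) (hmin.hasFDerivAt_eq_zero hd)
  simp only [sub_apply, innerSL_apply_apply,
    zero_apply] at this
  linarith

/-- A cyclically monotone set with bounded second components is single valued over almost every
point. -/
theorem IsCyclicallyMonotone.exists_conull_injOn {E : Type*} [NormedAddCommGroup E]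
    [InnerProductSpace ℝ E] [FiniteDimensional ℝ E] [MeasurableSpace E] [BorelSpace E]
    (ν : Measure E) [ν.IsAddHaarMeasure] {R : Set (E × E)} (hR : IsCyclicallyMonotone R)
    {M : ℝ≥0} (hM : ∀ r ∈ R, ‖r.2‖ ≤ M) :
    ∃ D : Set E, MeasurableSet D ∧ ν Dᶜ = 0 ∧
      ∀ x ∈ D, ∀ y y', (x, y) ∈ R → (x, y') ∈ R → y = y' := by
  obtain ⟨φ, hφ, hsub⟩ := hR.exists_lipschitz_potential hM
  refine ⟨{x | DifferentiableAt ℝ φ x}, measurableSet_of_differentiableAt ℝ φ,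
    hφ.ae_differentiableAt, fun x hx y y' hy hy' => ext_inner_right ℝ fun v => ?_⟩
  rw [inner_eq_fderiv_of_subgradient hx (hsub _ hy), inner_eq_fderiv_of_subgradient hx (hsub _ hy')]

/-! ### Optimality and rearrangements of the support -/

/-- Rearranging the coordinates of finitely many points of `Γ` by permutations does not increase
the total of `b`. -/
def IsJointlyMonotone {ι : Type*} {Y : ι → Type*} (b : (∀ i, Y i) → ℝ) (Γ : Set (∀ i, Y i)) :
    Prop :=
  ∀ (I : Type) [Fintype I] (z : I → ∀ i, Y i), (∀ j, z j ∈ Γ) → ∀ σ : ι → Equiv.Perm I,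
    ∑ j, b (fun i => z (σ i j) i) ≤ ∑ j, b (z j)

/-- A small multiple of the sum of finitely many conditional measures is below the measure. -/
theorem exists_smul_sum_cond_le {Ω I : Type*} [MeasurableSpace Ω] [Fintype I] (γ : Measure Ω)
    [IsFiniteMeasure γ] (U : I → Set Ω) (hU : ∀ j, MeasurableSet (U j)) (hpos : ∀ j, γ (U j) ≠ 0) :
    ∃ ε : ℝ≥0∞, ε ≠ 0 ∧ ε ≠ ∞ ∧ ε • ∑ j, ProbabilityTheory.cond γ (U j) ≤ γ := by
  have hS : ∑ j, (γ (U j))⁻¹ ≠ ∞ := by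
    simp [ENNReal.sum_eq_top, hpos]
  -- The summand 1 keeps ε finite even when `I` is empty.
  refine ⟨(1 + ∑ j, (γ (U j))⁻¹)⁻¹, ?_, ?_, ?_⟩
  · simp [ENNReal.add_eq_top, hS]
  · simp
  · refine Measure.le_iff.2 fun s _ => ?_
    have h1 : ∀ j, ProbabilityTheory.cond γ (U j) s ≤ (γ (U j))⁻¹ * γ s := fun j => by
      rw [ProbabilityTheory.cond_apply (hU j)]
      gcongr
      exact Set.inter_subset_right
    simp only [Measure.smul_apply, Measure.coe_finsetSum, Finset.sum_apply, smul_eq_mul]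
    calc (1 + ∑ j, (γ (U j))⁻¹)⁻¹ * ∑ j, ProbabilityTheory.cond γ (U j) s
        ≤ (1 + ∑ j, (γ (U j))⁻¹)⁻¹ * ((1 + ∑ j, (γ (U j))⁻¹) * γ s) := by
          gcongr
          rw [add_mul, Finset.sum_mul]
          exact (Finset.sum_le_sum fun j _ => h1 j).trans le_add_self
      _ ≤ γ s := by
          rw [← mul_assoc]
          exact (mul_le_mul_left (ENNReal.inv_mul_le_one _) _).trans (one_mul _).le

/-- The support of an optimal plan for a bounded continuous surplus is jointly monotone. -/
theorem IsKantorovichSolution.isJointlyMonotone_support {ι : Type*} [Finite ι] {Y : ι → Type*}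
    [∀ i, TopologicalSpace (Y i)] [∀ i, SecondCountableTopology (Y i)]
    [∀ i, MeasurableSpace (Y i)] [∀ i, BorelSpace (Y i)] {b : (∀ i, Y i) → ℝ}
    (hb : Continuous b) {B : ℝ} (hB : ∀ x, |b x| ≤ B) {μ : ∀ i, Measure (Y i)}
    {γ : Measure (∀ i, Y i)} (hγ : IsKantorovichSolution b μ γ) :
    IsJointlyMonotone b γ.support := by
  classical
  have := Fintype.ofFinite ι
  intro I _ z hz σ
  by_contra! hlt
  obtain ⟨⟨hprob, hmarg⟩, hopt⟩ := hγ
  let r : (I → ∀ i, Y i) → I → ∀ i, Y i := fun w j i => w (σ i j) i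
  have hrc : ∀ j, Continuous fun w => r w j := fun j =>
    continuous_pi fun i => (continuous_apply i).comp (continuous_apply (σ i j))
  have hrm : ∀ j, Measurable fun w => r w j := fun j =>
    measurable_pi_lambda _ fun i => (measurable_pi_apply i).comp (measurable_pi_apply (σ i j))
  let F : (I → ∀ i, Y i) → ℝ := fun w => ∑ j, (b (r w j) - b (w j))
  have hF : Continuous F :=
    continuous_finsetSum _ fun j _ => (hb.comp (hrc j)).sub (hb.comp (continuous_apply j))
  have hFz : 0 < F z := by
    simp only [F, Finset.sum_sub_distrib]
    exact sub_pos.2 hlt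
  obtain ⟨U, hU, hUF⟩ := isOpen_pi_iff'.1 (hF.isOpen_preimage _ isOpen_Ioi) z hFz
  have hUm : ∀ j, MeasurableSet (U j) := fun j => (hU j).1.measurableSet
  have hUpos : ∀ j, γ (U j) ≠ 0 := fun j =>
    ((Measure.mem_support_iff_forall _).1 (hz j) _ ((hU j).1.mem_nhds (hU j).2)).ne'
  let c : I → Measure (∀ i, Y i) := fun j => ProbabilityTheory.cond γ (U j)
  have hc : ∀ j, IsProbabilityMeasure (c j) := fun j =>
    ProbabilityTheory.cond_isProbabilityMeasure (hUpos j)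
  obtain ⟨ε, hε0, hεt, hεγ⟩ := exists_smul_sum_cond_le γ U hUm hUpos
  -- Under `P` the points `w j` are independent with laws `c j`, so almost surely `w` lies in the
  -- product of the `U j`, where rearranging strictly gains. The competitor `γ'` replaces the laws
  -- `c j` inside γ by those of the rearranged points.
  let P : Measure (I → ∀ i, Y i) := Measure.pi c
  let η : I → Measure (∀ i, Y i) := fun j => P.map fun w => r w j
  have hη : ∀ j, IsProbabilityMeasure (η j) := fun j =>
    Measure.isProbabilityMeasure_map (hrm j).aemeasurable
  have hPev : ∀ j, P.map (fun w => w j) = c j := fun j => (measurePreserving_eval c j).map_eq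
  have hεc : IsFiniteMeasure (ε • ∑ j, c j) := isFiniteMeasure_of_le γ hεγ
  let ρ : Measure (∀ i, Y i) := γ - ε • ∑ j, c j
  have hργ : ρ + ε • ∑ j, c j = γ := Measure.sub_add_cancel_of_le hεγ
  let γ' : Measure (∀ i, Y i) := ρ + ε • ∑ j, η j
  have hρ : IsFiniteMeasure ρ := isFiniteMeasure_of_le γ Measure.sub_le
  -- The i-th marginal of `η j` is that of `c (σ i j)`, and `σ i` merely permutes the summands.
  have hmargsum : ∀ i, (∑ j, η j).map (fun x => x i) = (∑ j, c j).map (fun x => x i) := by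
    intro i
    have hm : Measurable fun x : ∀ i, Y i => x i := measurable_pi_apply i
    rw [Measure.map_finset_sum hm.aemeasurable, Measure.map_finset_sum hm.aemeasurable,
      ← Equiv.sum_comp (σ i) fun j => (c j).map fun x => x i]
    refine Finset.sum_congr rfl fun j _ => ?_
    rw [Measure.map_map hm (hrm j), ← hPev, Measure.map_map hm (measurable_pi_apply _)]
    rfl
  have hγ' : HasMarginals μ γ' := by
    constructor
    · constructor
      have h1 : γ' Set.univ = (ρ + ε • ∑ j, c j) Set.univ := by
        simp [γ']
      rw [h1, hργ, measure_univ]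
    · intro i
      have hm : Measurable fun x : ∀ i, Y i => x i := measurable_pi_apply i
      rw [← hmarg i, ← hργ, Measure.map_add _ _ hm, Measure.map_add _ _ hm, Measure.map_smul,
        Measure.map_smul, hmargsum]
  have hint : ∀ (ν : Measure (∀ i, Y i)) [IsFiniteMeasure ν], Integrable b ν := fun ν _ =>
    Integrable.of_bound hb.aestronglyMeasurable B (Filter.Eventually.of_forall hB)
  have hsum : ∀ (ν : I → Measure (∀ i, Y i)) [∀ j, IsProbabilityMeasure (ν j)],
      ∫ x, b x ∂(ρ + ε • ∑ j, ν j) = ∫ x, b x ∂ρ + ε.toReal * ∑ j, ∫ x, b x ∂(ν j) := by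
    intro ν _
    have hfin : IsFiniteMeasure (ε • ∑ j, ν j) := by
      refine ⟨?_⟩
      simp [ENNReal.mul_lt_top_iff, hεt.lt_top]
    rw [integral_add_measure (hint _) (hint _), integral_smul_measure,
      integral_finsetSum_measure fun j _ => hint _, smul_eq_mul]
  have h1 := hopt γ' hγ'
  rw [← hργ, hsum η, hsum c] at h1
  have h2 : ∑ j, ∫ x, b x ∂(η j) ≤ ∑ j, ∫ x, b x ∂(c j) :=
    le_of_mul_le_mul_left (by linarith) (ENNReal.toReal_pos hε0 hεt)
  have hPint : ∀ (f : (I → ∀ i, Y i) → ∀ i, Y i), Continuous f → Integrable (fun w => b (f w)) P :=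
    fun f hf => Integrable.of_bound (hb.comp hf).aestronglyMeasurable B
      (Filter.Eventually.of_forall fun _ => hB _)
  have hFi : ∀ j, Integrable (fun w => b (r w j) - b (w j)) P := fun j =>
    (hPint _ (hrc j)).sub (hPint _ (continuous_apply j))
  have h3 : ∫ w, F w ∂P = ∑ j, ∫ x, b x ∂(η j) - ∑ j, ∫ x, b x ∂(c j) := by
    simp only [F]
    rw [integral_finsetSum _ fun j _ => hFi j, ← Finset.sum_sub_distrib]
    refine Finset.sum_congr rfl fun j _ => ?_
    rw [integral_sub (hPint _ (hrc j)) (hPint _ (continuous_apply j)),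
      integral_map (hrm j).aemeasurable hb.aestronglyMeasurable, ← hPev j,
      integral_map (measurable_pi_apply j).aemeasurable hb.aestronglyMeasurable]
  have hFpos : ∀ᵐ w ∂P, 0 < F w := by
    have : ∀ j, ∀ᵐ w ∂P, w j ∈ U j := fun j =>
      (measurePreserving_eval c j).quasiMeasurePreserving.ae (ProbabilityTheory.ae_cond_mem (hUm j))
    filter_upwards [ae_all_iff.2 this] with w hw
    exact hUF fun j _ => hw j
  have hFint : Integrable F P := integrable_finsetSum _ fun j _ => hFi j
  have h4 : 0 < ∫ w, F w ∂P := by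
    rw [integral_pos_iff_support_of_nonneg_ae (hFpos.mono fun _ h => h.le) hFint]
    have : P (Function.support F) = 1 := by
      rw [← measure_univ (μ := P)]
      exact measure_congr (Filter.eventuallyEq_univ.2 (hFpos.mono fun _ h => h.ne'))
    simp [this]
  linarith

/-! ### The quadratic form of a graph -/

section GraphForm

variable {V E : Type*} [Fintype V] [NormedAddCommGroup E]

open Classical in
/-- The sum of the values of `f` over the neighbours of `i`. -/
noncomputable def nbrSum (G : SimpleGraph V) (f : V → E) (i : V) : E :=
  ∑ k, if G.Adj i k then f k else 0

variable (G : SimpleGraph V)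

theorem nbrSum_add (f g : V → E) (i : V) : nbrSum G (f + g) i = nbrSum G f i + nbrSum G g i := by
  simp only [nbrSum, ← Finset.sum_add_distrib]
  exact Finset.sum_congr rfl fun k _ => by split_ifs <;> simp

theorem nbrSum_sub (f g : V → E) (i : V) : nbrSum G (f - g) i = nbrSum G f i - nbrSum G g i := by
  simp only [nbrSum, ← Finset.sum_sub_distrib]
  exact Finset.sum_congr rfl fun k _ => by split_ifs <;> simp

-- Sums over closed neighbourhoods coincide for vertices of one clique block; rigidity rests on
-- comparing them.
open Classical in
theorem nbrSum_add_self (f : V → E) (i : V) :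
    nbrSum G f i + f i = ∑ k, if k = i ∨ G.Adj i k then f k else 0 := by
  have h : f i = ∑ k, if k = i then f k else 0 := by simp
  rw [nbrSum, h, ← Finset.sum_add_distrib]
  refine Finset.sum_congr rfl fun k _ => ?_
  by_cases hk : k = i
  · subst hk; simp
  · simp [hk]

open Classical in
theorem nbrSum_single_self (i : V) (v : E) : nbrSum G (Pi.single i v) i = 0 := by
  refine Finset.sum_eq_zero fun k _ => ?_
  split_ifs with h
  · exact Pi.single_eq_of_ne h.ne' _
  · rfl

theorem norm_nbrSum_le {f : V → E} {r : ℝ} (hr : 0 ≤ r) (hf : ∀ i, ‖f i‖ ≤ r) (v : V) :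
    ‖nbrSum G f v‖ ≤ Fintype.card V * r := by
  classical
  refine (norm_sum_le _ _).trans ((Finset.sum_le_card_nsmul _ _ r fun i _ => ?_).trans_eq ?_)
  · split_ifs
    · exact hf i
    · simpa using hr
  · simp

variable [InnerProductSpace ℝ E]

/-- The symmetric bilinear form `∑ ⟪f i, g k⟫` over all ordered pairs of adjacent vertices. -/
noncomputable def edgeForm (f g : V → E) : ℝ :=
  ∑ i, ⟪f i, nbrSum G g i⟫

theorem edgeForm_add_left (f f' g : V → E) :
    edgeForm G (f + f') g = edgeForm G f g + edgeForm G f' g := by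
  simp [edgeForm, inner_add_left, Finset.sum_add_distrib]

theorem edgeForm_add_right (f g g' : V → E) :
    edgeForm G f (g + g') = edgeForm G f g + edgeForm G f g' := by
  simp [edgeForm, nbrSum_add, inner_add_right, Finset.sum_add_distrib]

theorem edgeForm_sub_left (f f' g : V → E) :
    edgeForm G (f - f') g = edgeForm G f g - edgeForm G f' g := by
  simp [edgeForm, inner_sub_left, Finset.sum_sub_distrib]

theorem edgeForm_sub_right (f g g' : V → E) :
    edgeForm G f (g - g') = edgeForm G f g - edgeForm G f g' := by
  simp [edgeForm, nbrSum_sub, inner_sub_right, Finset.sum_sub_distrib]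

open Classical in
theorem edgeForm_eq_sum (f g : V → E) :
    edgeForm G f g = ∑ i, ∑ k, if G.Adj i k then ⟪f i, g k⟫ else 0 := by
  refine Finset.sum_congr rfl fun i _ => ?_
  rw [nbrSum, inner_sum]
  exact Finset.sum_congr rfl fun k _ => by split_ifs <;> simp

theorem edgeForm_comm (f g : V → E) : edgeForm G f g = edgeForm G g f := by
  classical
  rw [edgeForm_eq_sum, edgeForm_eq_sum, Finset.sum_comm]
  simp only [G.adj_comm, real_inner_comm]

/-- Exchanging the coordinates in `C` of two families changes the total of the quadratic form by
the interaction of their difference across the boundary of `C`. -/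
theorem edgeForm_exchange (x x' : V → E) (e : V → E) :
    edgeForm G (x - e) (x - e) + edgeForm G (x' + e) (x' + e) =
      edgeForm G x x + edgeForm G x' x' - 2 * edgeForm G (x - x' - e) e := by
  simp only [edgeForm_add_left, edgeForm_add_right, edgeForm_sub_left, edgeForm_sub_right]
  rw [edgeForm_comm G e x, edgeForm_comm G e x']
  ring

open Classical in
theorem edgeForm_single_right (f : V → E) (i : V) (v : E) :
    edgeForm G f (Pi.single i v) = ⟪nbrSum G f i, v⟫ := by
  rw [edgeForm_comm, edgeForm, Finset.sum_eq_single i]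
  · rw [Pi.single_eq_same, real_inner_comm]
  · intro k _ hk
    simp [Pi.single_eq_of_ne hk]
  · simp

-- Without loops the quadratic term in the increment vanishes, so the form is affine in each
-- coordinate.
open Classical in
theorem edgeForm_update (f : V → E) (i : V) (v : E) :
    edgeForm G (Function.update f i v) (Function.update f i v) =
      edgeForm G f f + 2 * ⟪nbrSum G f i, v - f i⟫ := by
  have h : Function.update f i v = f + Pi.single i (v - f i) := by
    ext k
    by_cases hk : k = i
    · subst hk; simp
    · simp [hk]
  rw [h, edgeForm_add_left, edgeForm_add_right, edgeForm_add_right,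
    edgeForm_comm G (Pi.single i _) f, edgeForm_single_right, edgeForm_single_right,
    nbrSum_single_self]
  simp
  ring

end GraphForm

/-! ### Hub combinatorics and rigidity -/

/-- The combinatorial content of an inner hub: hub vertices are adjacent to all other vertices. -/
theorem IsInnerHub.adj {V : Type*} [Finite V] {G : SimpleGraph V} {A : Set V}
    (hA : IsInnerHub G A) {a k : V} (ha : a ∈ A) (hk : k ≠ a) : G.Adj a k := by
  by_cases htop : G = ⊤
  · rw [htop]; exact hk.symm
  have hcl : ∀ s : Set V, G.IsClique s → ∃ S, s ⊆ S ∧ Maximal G.IsClique S := fun s hs =>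
    Finite.exists_le_maximal hs
  obtain ⟨S, hkS, hS⟩ := hcl {k} (by simp)
  -- If S were the only maximal clique it would contain every vertex, and G would be complete.
  obtain ⟨T, hT, hne⟩ : ∃ T, Maximal G.IsClique T ∧ S ≠ T := by
    by_contra! h
    refine htop (eq_top_iff.2 fun u v huv => ?_)
    obtain ⟨S₁, hu, hS₁⟩ := hcl {u} (by simp)
    obtain ⟨S₂, hv, hS₂⟩ := hcl {v} (by simp)
    rw [← h _ hS₁] at hu
    rw [← h _ hS₂] at hv
    exact hS.1 (hu rfl) (hv rfl) huv
  rw [← hA.1 S T hS hT hne] at ha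
  exact hS.1 ha.1 (hkS rfl) hk.symm

/-- Off an inner hub, adjacency is transitive: the hub's complement is a disjoint union of
cliques. -/
theorem IsInnerHub.adj_trans {V : Type*} [Finite V] {G : SimpleGraph V} {A : Set V}
    (hA : IsInnerHub G A) {i j k : V} (hj : j ∉ A) (hij : G.Adj i j) (hjk : G.Adj j k)
    (hik : i ≠ k) : G.Adj i k := by
  have hcl : ∀ u v, G.Adj u v → ∃ S, u ∈ S ∧ v ∈ S ∧ Maximal G.IsClique S := by
    intro u v huv
    obtain ⟨S, h, hS⟩ := Finite.exists_le_maximal (p := G.IsClique) (a := {u, v})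
      (by rw [SimpleGraph.isClique_pair]; exact fun _ => huv)
    exact ⟨S, h (by simp), h (by simp), hS⟩
  obtain ⟨S, hi, hjS, hS⟩ := hcl i j hij
  obtain ⟨T, hjT, hk, hT⟩ := hcl j k hjk
  by_cases hST : S = T
  · subst hST
    exact hS.1 hi hk hik
  · exact absurd (hA.1 S T hS hT hST ▸ ⟨hjS, hjT⟩) hj

open Classical in
/-- Rigidity: a difference of two families that is monotone under all exchanges, vanishes
together with its neighbour sum at a vertex `o`, and is compatible with mixing at a hub vertex `p`,
is zero. -/
theorem eq_zero_of_exchange_nonneg {V E : Type*} [Fintype V] [NormedAddCommGroup E]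
    [InnerProductSpace ℝ E] {G : SimpleGraph V} {A : Set V} (hA : IsInnerHub G A) {d : V → E}
    {o p : V} (hp : p ∈ A)
    (hex : ∀ C : Set V, 0 ≤ edgeForm G (d - C.indicator d) (C.indicator d))
    (ho : d o = 0) (hNo : nbrSum G d o = 0)
    (hmix : ∀ C : Set V, p ∉ C → d p = 0 →
      (∀ i ∈ C, ∀ k ∉ C, G.Adj i k → d i = 0 ∨ d k = 0) → nbrSum G (C.indicator d) p = 0) :
    d = 0 := by
  have hsingle : ∀ i, 0 ≤ ⟪nbrSum G d i, d i⟫ := by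
    intro i
    have h := hex {i}
    have hs : ({i} : Set V).indicator d = Pi.single i (d i) := by
      ext k
      by_cases hk : k = i
      · subst hk; simp
      · simp [hk]
    rw [hs, edgeForm_single_right, nbrSum_sub, nbrSum_single_self, sub_zero] at h
    exact h
  have hzero : ∀ i, nbrSum G d i + d i = 0 → d i = 0 := by
    intro i hi
    have h := hsingle i
    rw [eq_neg_of_add_eq_zero_left hi, inner_neg_left] at h
    exact real_inner_self_nonpos.1 (by linarith)
  have hhub : ∀ i ∈ A, nbrSum G d i + d i = ∑ k, d k := by
    intro i hi
    rw [nbrSum_add_self]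
    refine Finset.sum_congr rfl fun k _ => if_pos ?_
    by_cases hk : k = i
    · exact Or.inl hk
    · exact Or.inr (hA.adj hi hk)
  have hzeroA : ∀ i ∈ A, d i = 0 := by
    by_cases hoA : o ∈ A
    · intro i hi
      apply hzero
      rw [hhub i hi, ← hhub o hoA, hNo, ho, add_zero]
    -- Such an i has the same closed neighbourhood as o, hence the same vanishing closed sum.
    · have hblock : ∀ i, i ∉ A → G.Adj o i → d i = 0 := by
        intro i hi hoi
        apply hzero
        have h0 : nbrSum G d o + d o = 0 := by rw [hNo, ho, add_zero]
        rw [← h0, nbrSum_add_self, nbrSum_add_self]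
        refine Finset.sum_congr rfl fun k _ => ?_
        have : (k = i ∨ G.Adj i k) ↔ (k = o ∨ G.Adj o k) := by
          constructor
          · rintro (rfl | h)
            · exact Or.inr hoi
            · by_cases hk : k = o
              · exact Or.inl hk
              · exact Or.inr (hA.adj_trans hi hoi h (Ne.symm hk))
          · rintro (rfl | h)
            · exact Or.inr hoi.symm
            · by_cases hk : k = i
              · exact Or.inl hk
              · exact Or.inr (hA.adj_trans hoA hoi.symm h (Ne.symm hk))
        simp only [this]
      have hsumA : ∑ k, A.indicator d k = 0 := by
        rw [← hNo, nbrSum]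
        refine Finset.sum_congr rfl fun k _ => ?_
        by_cases hk : k ∈ A
        · have hok : G.Adj o k := (hA.adj hk fun h : o = k => hoA (h ▸ hk)).symm
          simp [hk, hok]
        · by_cases hok : G.Adj o k
          · simp [hk, hok, hblock k hk hok]
          · simp [hk, hok]
      intro i hi
      have h1 := hsingle i
      rw [eq_sub_of_add_eq (hhub i hi), inner_sub_left] at h1
      -- Everything outside this set is in the hub, so all edges across the cut are present and the
      -- form is a product of two sums. With s the sum of d, it equals ⟪-d i, d i + s⟫; added to ⟪s
      -- - d i, d i⟫ ≥ 0 from `hsingle`, this forces d i = 0.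
      have h2 := hex (insert i Aᶜ)
      have h3 : edgeForm G (d - (insert i Aᶜ).indicator d) ((insert i Aᶜ).indicator d) =
          ⟪∑ k, (d - (insert i Aᶜ).indicator d) k, ∑ k, (insert i Aᶜ).indicator d k⟫ := by
        rw [edgeForm_eq_sum, sum_inner]
        refine Finset.sum_congr rfl fun k _ => ?_
        rw [inner_sum]
        refine Finset.sum_congr rfl fun l _ => ?_
        by_cases hk : k ∈ insert i Aᶜ
        · simp [Set.indicator_of_mem hk]
        by_cases hl : l ∈ insert i Aᶜ
        · have hkA : k ∈ A := by
            by_contra h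
            exact hk (Or.inr h)
          rw [if_pos (hA.adj hkA fun h : l = k => hk (h ▸ hl))]
        · simp [Set.indicator_of_notMem hl]
      have h4 : ∑ k, (insert i Aᶜ).indicator d k = d i + ∑ k, d k := by
        have : ∀ k, (insert i Aᶜ).indicator d k =
            (if k = i then d k else 0) + (d k - A.indicator d k) := by
          intro k
          by_cases hk : k = i
          · subst hk; simp [hi]
          · by_cases hkA : k ∈ A <;> simp [hk, hkA]
        simp [this, Finset.sum_add_distrib, hsumA]
      rw [h3, Finset.sum_congr rfl fun k _ => Pi.sub_apply d _ k, Finset.sum_sub_distrib, h4] at h2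
      simp only [sub_add_cancel_right, inner_neg_left, inner_add_right] at h2
      rw [real_inner_comm] at h1
      exact real_inner_self_nonpos.1 (by linarith)
  ext1 k
  by_cases hk : k ∈ A
  · exact hzeroA k hk
  apply hzero
  -- The clique of k without the hub. Edges leaving it end in the hub, where d is already zero, so
  -- exchanging it is admissible; p sees all of it, so the neighbour sum at p is the closed sum at
  -- k.
  let C : Set V := {j | j ∉ A ∧ (j = k ∨ G.Adj k j)}
  have hpC : p ∉ C := fun h => h.1 hp
  have hC := hmix C hpC (hzeroA p hp) fun i hi j hj hij => by
    right
    refine hzeroA j ?_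
    by_contra hjA
    refine hj ⟨hjA, ?_⟩
    rcases hi.2 with rfl | h
    · exact Or.inr hij
    · by_cases hjk : j = k
      · exact Or.inl hjk
      · exact Or.inr (hA.adj_trans hi.1 h hij (Ne.symm hjk))
  rw [← hC, nbrSum_add_self, nbrSum]
  refine Finset.sum_congr rfl fun j _ => ?_
  by_cases hjA : j ∈ A
  · simp [hzeroA j hjA, C, hjA]
  · have hpj : G.Adj p j := hA.adj hp fun h => hjA (h ▸ hp)
    simp [Set.indicator_apply, C, hjA, hpj]

/-! ### Exchanges and mixtures -/

section Coordinates

variable {V E : Type*} {X : V → Set E}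

/-- The family of points of `E` underlying a point of `∏ i, X i`. -/
def coords (x : ∀ i, X i) : V → E := fun i => x i

theorem coords_injective : Function.Injective (coords (X := X)) := fun _ _ h =>
  funext fun i => Subtype.ext (congrFun h i)

open Classical in
theorem coords_piecewise [AddCommGroup E] (C : Set V) (x x' : ∀ i, X i) :
    coords (C.piecewise x' x) = coords x - C.indicator (coords x - coords x') := by
  ext1 i
  by_cases hi : i ∈ C <;> simp [coords, hi]

open Classical in
theorem coords_piecewise' [AddCommGroup E] (C : Set V) (x x' : ∀ i, X i) :
    coords (C.piecewise x x') = coords x' + C.indicator (coords x - coords x') := by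
  ext1 i
  by_cases hi : i ∈ C <;> simp [coords, hi]

open Classical in
theorem coords_update (x : ∀ i, X i) (v : V) (a : X v) :
    coords (Function.update x v a) = Function.update (coords x) v (a : E) := by
  ext1 i
  by_cases hi : i = v
  · subst hi; simp [coords]
  · simp [coords, hi]

variable [Fintype V] [NormedAddCommGroup E] [InnerProductSpace ℝ E] (G : SimpleGraph V)

/-- Points obtained from two points `z`, `w` of `Γ` by exchanging a set `C` of coordinates such
that `z` and `w` agree at one endpoint of every edge leaving `C`. -/
def mixtures (Γ : Set (∀ i, X i)) : Set (∀ i, X i) := open Classical in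
  {y | ∃ z ∈ Γ, ∃ w ∈ Γ, ∃ C : Set V, y = C.piecewise w z ∧
    ∀ i ∈ C, ∀ k ∉ C, G.Adj i k → z i = w i ∨ z k = w k}

variable {G} {Γ : Set (∀ i, X i)}

/-- Exchanging the coordinates in `C` of two points of a jointly monotone set. -/
theorem IsJointlyMonotone.edgeForm_nonneg
    (hΓ : IsJointlyMonotone (fun x => edgeForm G (coords x) (coords x)) Γ) {x x' : ∀ i, X i}
    (hx : x ∈ Γ) (hx' : x' ∈ Γ) (C : Set V) :
    0 ≤ edgeForm G (coords x - coords x' - C.indicator (coords x - coords x'))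
      (C.indicator (coords x - coords x')) := by
  classical
  have h := hΓ Bool (fun j => bif j then x' else x) (by simp [hx, hx'])
    fun i => if i ∈ C then Equiv.boolNot else Equiv.refl _
  have h1 : (fun i => (bif (if i ∈ C then Equiv.boolNot else Equiv.refl _) true then x' else x) i)
      = C.piecewise x x' := by
    ext i
    by_cases hi : i ∈ C <;> simp [hi]
  have h2 : (fun i => (bif (if i ∈ C then Equiv.boolNot else Equiv.refl _) false then x' else x) i)
      = C.piecewise x' x := by
    ext i
    by_cases hi : i ∈ C <;> simp [hi]
  simp only [Fintype.sum_bool, h1, h2, cond_true, cond_false] at h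
  rw [coords_piecewise C x x', coords_piecewise' C x x'] at h
  have := edgeForm_exchange G (coords x) (coords x') (C.indicator (coords x - coords x'))
  linarith

open Classical in
/-- Admissible mixing preserves the total of the quadratic form. -/
theorem edgeForm_piecewise_add {z w : ∀ i, X i} {C : Set V}
    (hC : ∀ i ∈ C, ∀ k ∉ C, G.Adj i k → z i = w i ∨ z k = w k) :
    edgeForm G (coords (C.piecewise w z)) (coords (C.piecewise w z)) +
        edgeForm G (coords (C.piecewise z w)) (coords (C.piecewise z w)) =
      edgeForm G (coords z) (coords z) + edgeForm G (coords w) (coords w) := by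
  rw [coords_piecewise, coords_piecewise', edgeForm_exchange]
  have : edgeForm G (coords z - coords w - C.indicator (coords z - coords w))
      (C.indicator (coords z - coords w)) = 0 := by
    rw [edgeForm_eq_sum]
    refine Finset.sum_eq_zero fun k _ => Finset.sum_eq_zero fun i _ => ?_
    by_cases hk : k ∈ C
    · simp [hk]
    by_cases hi : i ∈ C
    · split_ifs with hki
      · rcases hC i hi k hk hki.symm with h | h <;> simp [coords, h, hi, hk]
      · rfl
    · simp [hi]
  rw [this, mul_zero, sub_zero]

/-- For the mixtures of a jointly monotone set, the pairs formed by one coordinate and the sum of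
the neighbouring coordinates are cyclically monotone. -/
theorem IsJointlyMonotone.isCyclicallyMonotone_mixtures
    (hΓ : IsJointlyMonotone (fun x => edgeForm G (coords x) (coords x)) Γ) (v : V) :
    IsCyclicallyMonotone
      ((fun y : ∀ i, X i => ((y v : E), nbrSum G (coords y) v)) '' mixtures G Γ) := by
  classical
  intro k f hf
  choose y hy hyf using hf
  choose z hz w hw C hyC hC using hy
  let Z : Fin (k + 1) × Bool → ∀ i, X i := fun j => bif j.2 then w j.1 else z j.1
  have hZ : ∀ j, Z j ∈ Γ := by
    rintro ⟨j, b | b⟩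
    · exact hz j
    · exact hw j
  -- `τ` puts the mixture `y j` in slot `(j, false)` and the complementary mixture in `(j, true)`;
  -- `π` then rotates the `false` slots, at the coordinate v only.
  let τ : V → Equiv.Perm (Fin (k + 1) × Bool) := fun u =>
    Equiv.prodShear (Equiv.refl _) fun j : Fin (k + 1) =>
      if u ∈ C j then Equiv.boolNot else Equiv.refl _
  let π : Equiv.Perm (Fin (k + 1) × Bool) :=
    (Equiv.prodComm _ _).trans
      ((Equiv.prodShear (Equiv.refl Bool) fun b =>
        bif b then Equiv.refl _ else finRotate (k + 1)).trans (Equiv.prodComm _ _))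
  have h := hΓ _ Z hZ fun u => if u = v then π.trans (τ u) else τ u
  have hfalse : ∀ (j : Fin (k + 1)) (u : V), Z (τ u (j, false)) u = y j u := by
    intro j u
    rw [hyC]
    by_cases hu : u ∈ C j <;> simp [Z, τ, hu]
  have htrue : ∀ (j : Fin (k + 1)) (u : V),
      Z (τ u (j, true)) u = (C j).piecewise (z j) (w j) u := by
    intro j u
    by_cases hu : u ∈ C j <;> simp [Z, τ, hu]
  have h1 : ∀ j : Fin (k + 1),
      (fun u => Z ((if u = v then π.trans (τ u) else τ u) (j, false)) u) =
        Function.update (y j) v (y (finRotate (k + 1) j : Fin (k + 1)) v) := by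
    intro j
    ext1 u
    by_cases hu : u = v
    · subst hu
      simpa [π] using hfalse (finRotate (k + 1) j) u
    · simpa [hu] using hfalse j u
  have h2 : ∀ j : Fin (k + 1),
      (fun u => Z ((if u = v then π.trans (τ u) else τ u) (j, true)) u) =
        (C j).piecewise (z j) (w j) := by
    intro j
    ext1 u
    by_cases hu : u = v
    · subst hu
      simpa [π] using htrue j u
    · simpa [hu] using htrue j u
  -- By conservation, the complementary mixtures cancel and only the rotation of the `y j`
  -- contributes.
  have h3 : ∀ j : Fin (k + 1), edgeForm G (coords (z j)) (coords (z j)) =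
      edgeForm G (coords (y j)) (coords (y j)) +
        edgeForm G (coords ((C j).piecewise (z j) (w j)))
          (coords ((C j).piecewise (z j) (w j))) -
        edgeForm G (coords (w j)) (coords (w j)) := by
    intro j
    rw [eq_sub_iff_add_eq, ← edgeForm_piecewise_add (hC j), ← hyC]
  simp only [Fintype.sum_prod_type, Fintype.sum_bool, h1, h2, coords_update, edgeForm_update] at h
  simp only [Z, cond_true, cond_false, h3, Finset.sum_add_distrib, Finset.sum_sub_distrib,
    ← Finset.mul_sum] at h
  have h4 : ∑ j : Fin (k + 1), ⟪nbrSum G (coords (y j)) v,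
      (y (finRotate (k + 1) j : Fin (k + 1)) v : E) - coords (y j) v⟫ ≤ 0 := by linarith
  rw [Fin.sum_univ_castSucc] at h4
  rw [Finset.sum_range]
  simpa [← hyf, coords] using h4

/-- In a jointly monotone set, a point is determined by its coordinate at `o`, as long as the sets
of mixtures are single valued over the coordinates at `o` and at a hub vertex `p`. -/
theorem IsJointlyMonotone.eq_of_coord_eq {A : Set V} (hA : IsInnerHub G A)
    (hΓ : IsJointlyMonotone (fun x => edgeForm G (coords x) (coords x)) Γ) {o p : V} (hp : p ∈ A)
    {x x' : ∀ i, X i} (hx : x ∈ Γ) (hx' : x' ∈ Γ)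
    (huo : ∀ y ∈ mixtures G Γ, ∀ y' ∈ mixtures G Γ, y o = x o → y' o = x o →
      nbrSum G (coords y) o = nbrSum G (coords y') o)
    (hup : ∀ y ∈ mixtures G Γ, ∀ y' ∈ mixtures G Γ, y p = x p → y' p = x p →
      nbrSum G (coords y) p = nbrSum G (coords y') p)
    (hxo : x' o = x o) : x = x' := by
  classical
  have hsub : ∀ z ∈ Γ, z ∈ mixtures G Γ := fun z hz => ⟨z, hz, z, hz, ∅, by simp, by simp⟩
  refine coords_injective (sub_eq_zero.1 ?_)
  refine eq_zero_of_exchange_nonneg hA (o := o) hp (hΓ.edgeForm_nonneg hx hx') ?_ ?_ ?_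
  · simp [coords, hxo]
  · rw [nbrSum_sub, huo x (hsub x hx) x' (hsub x' hx') rfl hxo, sub_self]
  · intro C hpC hdp hC
    have hmem : C.piecewise x' x ∈ mixtures G Γ := by
      refine ⟨x, hx, x', hx', C, rfl, fun i hi k hk hik => ?_⟩
      rcases hC i hi k hk hik with h | h
      · exact Or.inl (Subtype.ext (sub_eq_zero.1 h))
      · exact Or.inr (Subtype.ext (sub_eq_zero.1 h))
    have h := hup _ hmem x (hsub x hx) (by simp [hpC]) rfl
    rw [coords_piecewise, nbrSum_sub] at h
    simpa using h

end Coordinates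

/-! ### From injectivity to the inducing map -/

theorem two_mul_graphSurplus {n m : ℕ} (G : SimpleGraph (Fin m))
    {X : Fin m → Set (EuclideanSpace ℝ (Fin n))} (x : ∀ i, X i) :
    edgeForm G (coords x) (coords x) = 2 * graphSurplus G x := by
  classical
  let g : Fin m × Fin m → ℝ := fun e => ⟪coords x e.1, coords x e.2⟫
  have h1 : graphSurplus G x =
      ∑ e : Fin m × Fin m, if e.1 < e.2 ∧ G.Adj e.1 e.2 then g e else 0 := by
    rw [graphSurplus, Finset.sum_filter]
    exact Finset.sum_congr rfl fun e _ => by congr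
  have h2 : graphSurplus G x =
      ∑ e : Fin m × Fin m, if e.2 < e.1 ∧ G.Adj e.1 e.2 then g e else 0 := by
    rw [h1, ← Equiv.sum_comp (Equiv.prodComm (Fin m) (Fin m))]
    refine Finset.sum_congr rfl fun e _ => ?_
    simp [g, G.adj_comm, real_inner_comm]
  rw [two_mul]
  nth_rewrite 1 [h1]
  rw [h2, ← Finset.sum_add_distrib, edgeForm_eq_sum, Fintype.sum_prod_type]
  refine Finset.sum_congr rfl fun i _ => Finset.sum_congr rfl fun k _ => ?_
  rcases lt_trichotomy i k with h | h | h
  · simp [h, h.not_gt, g]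
  · simp [h]
  · simp [h, h.not_gt, g]

theorem continuous_graphSurplus {n m : ℕ} (G : SimpleGraph (Fin m))
    (X : Fin m → Set (EuclideanSpace ℝ (Fin n))) :
    Continuous (graphSurplus G (X := X)) := by
  unfold graphSurplus
  fun_prop

/-- A plan that gives full mass to a Borel set on which the coordinate `i₀` is injective is induced
by a map. -/
theorem isInducedByMap_of_injOn {ι : Type*} [Countable ι] {Y : ι → Type*}
    [∀ i, MeasurableSpace (Y i)] [∀ i, StandardBorelSpace (Y i)] {i₀ : ι} {μ : ∀ i, Measure (Y i)}
    {γ : Measure (∀ i, Y i)} (hγ : HasMarginals μ γ) {K : Set (∀ i, Y i)} (hK : MeasurableSet K)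
    (hγK : ∀ᵐ x ∂γ, x ∈ K) (hinj : K.InjOn fun x => x i₀) : IsInducedByMap i₀ μ γ := by
  classical
  obtain ⟨hprob, hmarg⟩ := hγ
  have hm : ∀ i, Measurable fun x : ∀ i, Y i => x i := measurable_pi_apply
  have := hK.standardBorel
  -- Lusin–Souslin: an injective Borel map on a standard Borel space has a Borel inverse on its
  -- image.
  have hemb : MeasurableEmbedding fun x : K => (x : ∀ i, Y i) i₀ :=
    ((hm i₀).comp measurable_subtype_coe).measurableEmbedding
      (Set.injOn_iff_injective.1 hinj)
  obtain ⟨x₀⟩ : Nonempty (∀ i, Y i) := nonempty_of_isProbabilityMeasure γ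
  obtain ⟨g, hg, hgK⟩ := hemb.exists_measurable_extend measurable_subtype_coe fun _ => ⟨x₀⟩
  -- The update makes the `i₀` component the identity everywhere, also off the image of `K`.
  let S : Y i₀ → ∀ i, Y i := fun a => Function.update (g a) i₀ a
  have hS : Measurable S := by
    refine measurable_pi_lambda _ fun i => ?_
    by_cases hi : i = i₀
    · subst hi
      simp only [S, Function.update_self]
      exact measurable_id
    · simp only [S, Function.update_of_ne hi]
      exact (hm i).comp hg
  have hSγ : (μ i₀).map S = γ := by
    rw [← hmarg i₀, Measure.map_map hS (hm i₀)]
    conv_rhs => rw [← Measure.map_id (μ := γ)]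
    refine Measure.map_congr ?_
    filter_upwards [hγK] with x hx
    have : g (x i₀) = x := congrFun hgK ⟨x, hx⟩
    simp [S, this]
  refine ⟨fun i a => S a i, fun i => (hm i).comp hS, ?_, fun i => ?_, hSγ.symm⟩
  · ext1 a
    simp [S]
  · rw [← hmarg i, ← hSγ, Measure.map_map (hm i) hS]
    rfl

theorem theorem4p1 (n m : ℕ) [NeZero m]
    (X : Fin m → Set (EuclideanSpace ℝ (Fin n)))
    (hXo : ∀ i, IsOpen (X i)) (hXb : ∀ i, Bornology.IsBounded (X i))
    (G : SimpleGraph (Fin m)) (A : Set (Fin m)) (hA : IsInnerHub G A)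
    (μ : ∀ i, Measure (X i)) (hμ : ∀ i, IsProbabilityMeasure (μ i))
    (hμ₁ : (μ 0).map Subtype.val ≪ (volume : Measure (EuclideanSpace ℝ (Fin n))))
    (p : Fin m) (hp : p ∈ A)
    (hμp : (μ p).map Subtype.val ≪ (volume : Measure (EuclideanSpace ℝ (Fin n))))
    (γ : Measure (∀ i, X i)) (hγ : IsKantorovichSolution (graphSurplus G) μ γ) :
    IsInducedByMap 0 μ γ := by
  obtain ⟨r, hr0, hr⟩ : ∃ r : ℝ, 0 ≤ r ∧ ∀ i, ∀ a ∈ X i, ‖a‖ ≤ r := by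
    obtain ⟨r, hr⟩ := (Bornology.isBounded_iUnion.2 hXb).exists_norm_le
    exact ⟨max r 0, le_max_right _ _, fun i a ha =>
      (hr a (Set.mem_iUnion.2 ⟨i, ha⟩)).trans (le_max_left _ _)⟩
  have hM : ∀ (y : ∀ i, X i) v, ‖nbrSum G (coords y) v‖ ≤ m * r := fun y v => by
    simpa using norm_nbrSum_le G (f := coords y) hr0 (fun i => hr i _ (y i).2) v
  have hbound : ∀ x : ∀ i, X i, |graphSurplus G x| ≤ m * (r * (m * r)) := by
    intro x
    have h1 : |edgeForm G (coords x) (coords x)| ≤ m * (r * (m * r)) := by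
      refine (Finset.abs_sum_le_sum_abs _ _).trans
        ((Finset.sum_le_card_nsmul _ _ (r * (m * r)) fun i _ => ?_).trans_eq (by simp))
      refine (abs_real_inner_le_norm _ _).trans ?_
      exact mul_le_mul (hr i _ (x i).2) (hM x i) (norm_nonneg _) hr0
    rw [two_mul_graphSurplus, abs_mul, abs_two] at h1
    linarith [abs_nonneg (graphSurplus G x)]
  have hΓ : IsJointlyMonotone (fun x : ∀ i, X i => edgeForm G (coords x) (coords x))
      γ.support := by
    intro I _ z hz σ
    have := hγ.isJointlyMonotone_support (continuous_graphSurplus G X) hbound I z hz σ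
    simp only [two_mul_graphSurplus, ← Finset.mul_sum]
    linarith
  have hD : ∀ v, ∃ D : Set (EuclideanSpace ℝ (Fin n)), MeasurableSet D ∧ volume Dᶜ = 0 ∧
      ∀ a ∈ D, ∀ y ∈ mixtures G γ.support, ∀ y' ∈ mixtures G γ.support,
        (y v : EuclideanSpace ℝ (Fin n)) = a → (y' v : EuclideanSpace ℝ (Fin n)) = a →
        nbrSum G (coords y) v = nbrSum G (coords y') v := by
    intro v
    obtain ⟨D, hDm, hD0, hDu⟩ := (hΓ.isCyclicallyMonotone_mixtures v).exists_conull_injOn volume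
      (M := ⟨m * r, by positivity⟩) (by rintro _ ⟨y, _, rfl⟩; exact hM y v)
    refine ⟨D, hDm, hD0, fun a ha y hy y' hy' hya hya' => hDu a ha _ _ ⟨y, hy, ?_⟩ ⟨y', hy', ?_⟩⟩
    · simp [hya]
    · simp [hya']
  choose D hDm hD0 hDu using hD
  have hDae : ∀ v, (μ v).map Subtype.val ≪ (volume : Measure (EuclideanSpace ℝ (Fin n))) →
      ∀ᵐ x ∂γ, (x v : EuclideanSpace ℝ (Fin n)) ∈ D v := by
    intro v hv
    have h1 : ∀ᵐ a ∂(μ v).map Subtype.val, a ∈ D v := hv (hD0 v)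
    have h2 := ae_of_ae_map measurable_subtype_coe.aemeasurable h1
    rw [← hγ.1.2 v] at h2
    exact ae_of_ae_map (measurable_pi_apply v).aemeasurable h2
  have hmeas : ∀ v, MeasurableSet {x : ∀ i, X i | (x v : EuclideanSpace ℝ (Fin n)) ∈ D v} :=
    fun v => (measurable_subtype_coe.comp (measurable_pi_apply v)) (hDm v)
  have hstd : ∀ i, StandardBorelSpace (X i) := fun i => (hXo i).measurableSet.standardBorel
  refine isInducedByMap_of_injOn hγ.1
    (((Measure.isClosed_support (μ := γ)).measurableSet.inter (hmeas 0)).inter (hmeas p)) ?_ ?_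
  · filter_upwards [Measure.support_mem_ae, hDae 0 hμ₁, hDae p hμp] with x h1 h2 h3
    exact ⟨⟨h1, h2⟩, h3⟩
  -- Only x needs generic coordinates: x' shares the one at 0, and the mixtures at p are compared
  -- with x.
  · rintro x ⟨⟨hx, hx0⟩, hxp⟩ x' ⟨⟨hx', _⟩, _⟩ hxx'
    refine hΓ.eq_of_coord_eq hA (o := 0) hp hx hx' (fun y hy y' hy' h h' => ?_)
      (fun y hy y' hy' h h' => ?_) hxx'.symm
    · exact hDu 0 _ hx0 y hy y' hy' (congrArg _ h) (congrArg _ h')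
    · exact hDu p _ hxp y hy y' hy' (congrArg _ h) (congrArg _ h')
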